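/- Consider a Markov decision process with finite state space $\mathcal S$, finite action space $\mathcal A$, transition probabilities $P(s'\mid s,a)$, random rewards $R(r\mid s,a)$ and discount factor $\gamma\in[0,1]$, and put $\mathcal X=\mathcal S\times\mathcal A$. Let $\pi$ be a stationary policy. For $x\in\mathcal X$ let $Z^\pi(x)=\sum_{t\ge 0}\gamma^t r_t$ be the random return of a trajectory that starts with $(s_0,a_0)=x$ and follows $\pi$ afterwards; assume that for every $x$ the series converges absolutely and takes its values in $[R_{\min},R_{\max}]$ almost surely. Let $K\ge 1$, divide $[R_{\min},R_{\max}]$ into $K$ equal bins with end points $R_k=R_{\min}+k\,(R_{\max}-R_{\min})/K$, the $k$-th bin being $(R_{k-1},R_k]$ (and the first bin containing also $R_{\min}$), write $b(R)\in[K]$ for the bin that contains $R$, and let $\mathbb Z^\pi(x)\in\mathbb R^K$ be the vector with entries $\Pr[b(Z^\pi(x))=k]$. A map $\phi:\mathcal X\to[N]$ is a $Z^\pi$-irrelevance if $\phi(x_1)=\phi(x_2)$ implies $\mathbb Z^\pi(x_1)=\mathbb Z^\pi(x_2)$ for all $x_1,x_2\in\mathcal X$. Let $N\ge N_{\pi,K}$,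 where $N_{\pi,K}$ is the least $N$ for which a $Z^\pi$-irrelevance $\mathcal X\to[N]$ exists, and let $d$ be a probability distribution on $\mathcal X$ with $\mathrm{supp}(d)=\mathcal X$. Z-learning draws i.i.d. tuples $(x_1,x_2,y)$: $x_1,x_2\sim d$ independently, $R_1\sim Z^\pi(x_1)$ and $R_2\sim Z^\pi(x_2)$ independently, and $y=\mathbb I[b(R_1)\ne b(R_2)]$. From the dataset $\mathcal D$ of the first $n$ tuples (with multiplicity) it returns an encoder $\hat\phi_n$ such that, for some $\hat w$, the pair $(\hat\phi_n,\hat w)$ minimizes the empirical mean of $(w(\phi(x_1),\phi(x_2))-y)^2$ over $\mathcal D$ among all $\phi:\mathcal X\to[N]$ and all $w:[N]\times[N]\to[0,1]$. Then, as $n\to\infty$, the returned encoder is a $Z^\pi$-irrelevance, however ties between minimizers are broken. Precisely: almost surely, for all sufficiently large $n$, every encoder $\hat\phi_n$ that Z-learning may return is a $Z^\pi$-irrelevance, i.e. $\hat\phi_n(x_1)=\hat\phi_n(x_2)$ implies $\mathbb Z^\pi(x_1)=\mathbb Z^\pi(x_2)$ for all $x_1,x_2\in\mathcal X$; and the probability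 that every encoder that Z-learning may return on $n$ tuples is a $Z^\pi$-irrelevance tends to $1$. -/

import Mathlib

open MeasureTheory ProbabilityTheory Filter Topology

namespace ZLearning

/-- A Markov decision process with state space `S` and action space `A`: transition probabilities
`P(s' | s, a)`, (possibly random) rewards `R(r | s, a)` and a discount factor `γ`. The initial state
distribution plays no role in return distributions conditioned on the initial state-action pair,
and is omitted. -/
structure MDP (S A : Type*) [MeasurableSpace S] [MeasurableSpace A] where
  /-- transition probabilities -/
  trans : Kernel (S × A) S
  /-- reward distributions -/
  reward : Kernel (S × A) ℝ
  /-- discount factor -/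
  γ : ℝ
  trans_markov : IsMarkovKernel trans
  reward_markov : IsMarkovKernel reward
  γ_nonneg : 0 ≤ γ
  γ_le_one : γ ≤ 1

attribute [instance] MDP.trans_markov MDP.reward_markov

section Return

variable {S A : Type*} [MeasurableSpace S] [MeasurableSpace A]

/-- One step of the process under the stationary policy `π`: from the state-action pair
`(s, a)` draw `s' ∼ P(· | s, a)`, `a' ∼ π(· | s')` and then a reward `r' ∼ R(· | s', a')`. -/
noncomputable def stepKernel (M : MDP S A) (π : Kernel S A) : Kernel (S × A) ((S × A) × ℝ) :=
  (M.trans.compProd (π.prodMkLeft (S × A))).compProd (M.reward.prodMkLeft (S × A))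

instance (M : MDP S A) (π : Kernel S A) [IsMarkovKernel π] : IsMarkovKernel (stepKernel M π) := by
  unfold stepKernel; infer_instance

/-- The one-step kernel as a function of the whole history: only the last state-action pair
matters. -/
noncomputable def historyKernel (M : MDP S A) (π : Kernel S A) (n : ℕ) :
    Kernel ((i : Finset.Iic n) → (fun _ : ℕ => (S × A) × ℝ) i) ((S × A) × ℝ) :=
  (stepKernel M π).comap (fun h => (h ⟨n, Finset.mem_Iic.2 le_rfl⟩).1) (by fun_prop)

instance (M : MDP S A) (π : Kernel S A) [IsMarkovKernel π] (n : ℕ) :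
    IsMarkovKernel (historyKernel M π n) := by
  unfold historyKernel; infer_instance

/-- The law of the trajectory `((s₀, a₀), r₀), ((s₁, a₁), r₁), …` that starts with the state-action
pair `(s₀, a₀) = x` and follows the policy `π` afterwards. -/
noncomputable def trajectoryLaw (M : MDP S A) (π : Kernel S A) [IsMarkovKernel π] (x : S × A) :
    Measure (ℕ → (S × A) × ℝ) :=
  Kernel.trajMeasure (X := fun _ : ℕ => (S × A) × ℝ)
    ((Measure.dirac x).compProd M.reward) (historyKernel M π)

instance (M : MDP S A) (π : Kernel S A) [IsMarkovKernel π] (x : S × A) :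
    IsProbabilityMeasure (trajectoryLaw M π x) := by
  unfold trajectoryLaw; infer_instance

/-- The discounted sum of rewards `∑ₜ γᵗ rₜ` of a trajectory. -/
noncomputable def discountedReturn (M : MDP S A) (τ : ℕ → (S × A) × ℝ) : ℝ :=
  ∑' t, M.γ ^ t * (τ t).2

theorem measurable_discountedReturn (M : MDP S A) : Measurable (discountedReturn M) := by
  unfold discountedReturn
  exact Measurable.tsum fun t => by fun_prop

/-- The distribution of the return `Z^π(x)`. -/
noncomputable def returnLaw (M : MDP S A) (π : Kernel S A) [IsMarkovKernel π] (x : S × A) :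
    Measure ℝ :=
  (trajectoryLaw M π x).map (discountedReturn M)

instance (M : MDP S A) (π : Kernel S A) [IsMarkovKernel π] (x : S × A) :
    IsProbabilityMeasure (returnLaw M π x) :=
  Measure.isProbabilityMeasure_map (measurable_discountedReturn M).aemeasurable

/-- Under `π`, and from every initial state-action pair, the discounted sum of rewards converges
almost surely and takes its values in `[Rmin, Rmax]`. -/
def ReturnsIn (M : MDP S A) (π : Kernel S A) [IsMarkovKernel π] (Rmin Rmax : ℝ) : Prop :=
  ∀ x : S × A, ∀ᵐ τ ∂(trajectoryLaw M π x),
    (Summable fun t => M.γ ^ t * (τ t).2) ∧ discountedReturn M τ ∈ Set.Icc Rmin Rmax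

/-- The end points `R_k = Rmin + k (Rmax - Rmin) / K` of the `K` equal bins of `[Rmin, Rmax]`. -/
noncomputable def binEdge (Rmin Rmax : ℝ) (K k : ℕ) : ℝ := Rmin + k * ((Rmax - Rmin) / K)

/-- The `k`-th bin (counted from `0`): `(R_k, R_{k+1}]`, where the first bin also contains its left
end point `R_0 = Rmin`, so that the bins partition `[Rmin, Rmax]`. -/
def returnBin (Rmin Rmax : ℝ) (K : ℕ) (k : Fin K) : Set ℝ :=
  {R | (binEdge Rmin Rmax K k < R ∨ ((k : ℕ) = 0 ∧ R = Rmin)) ∧ R ≤ binEdge Rmin Rmax K (k + 1)}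

/-- The vector `ℤ^π(x)` of the probabilities that the return falls into each of the `K` bins. -/
noncomputable def binnedReturn (M : MDP S A) (π : Kernel S A) [IsMarkovKernel π] (Rmin Rmax : ℝ)
    (K : ℕ) (x : S × A) : Fin K → ℝ :=
  fun k => (returnLaw M π x).real (returnBin Rmin Rmax K k)

/-- `φ` is a `Z^π`-irrelevance: it identifies only state-action pairs with the same distribution of
the discretized return. -/
def IsZIrrelevance (M : MDP S A) (π : Kernel S A) [IsMarkovKernel π] (Rmin Rmax : ℝ) (K : ℕ)
    {N : ℕ} (φ : S × A → Fin N) : Prop :=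
  ∀ x₁ x₂, φ x₁ = φ x₂ →
    binnedReturn M π Rmin Rmax K x₁ = binnedReturn M π Rmin Rmax K x₂

/-- `N_{π,K}`: the least `N` such that a `Z^π`-irrelevance with values in `[N]` exists. -/
noncomputable def minAbstractSize (M : MDP S A) (π : Kernel S A) [IsMarkovKernel π]
    (Rmin Rmax : ℝ) (K : ℕ) : ℕ :=
  sInf {N | ∃ φ : S × A → Fin N, IsZIrrelevance M π Rmin Rmax K φ}

/-- The law of the raw data `((x₁, R₁), (x₂, R₂))` behind one tuple of the dataset: `x₁, x₂ ∼ d`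
independently, then `R₁ ∼ Z^π(x₁)` and `R₂ ∼ Z^π(x₂)` independently. -/
noncomputable def sampleLaw [Countable (S × A)] [MeasurableSingletonClass (S × A)] (M : MDP S A)
    (π : Kernel S A) [IsMarkovKernel π] (d : PMF (S × A)) :
    Measure (((S × A) × ℝ) × ((S × A) × ℝ)) :=
  (d.toMeasure.compProd (Kernel.ofFunOfCountable (returnLaw M π))).prod
    (d.toMeasure.compProd (Kernel.ofFunOfCountable (returnLaw M π)))

end Return

open Classical in
/-- The label `𝕀[b(R₁) ≠ b(R₂)]`: it is `0` if the two returns lie in the same bin, and `1`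
otherwise. -/
noncomputable def label (Rmin Rmax : ℝ) (K : ℕ) (R₁ R₂ : ℝ) : ℝ :=
  if ∃ k : Fin K, R₁ ∈ returnBin Rmin Rmax K k ∧ R₂ ∈ returnBin Rmin Rmax K k then 0 else 1

section Algorithm

variable {X : Type*}

/-- The dataset of `n` tuples `(x₁, x₂, y)` made from the first `n` raw data points. -/
noncomputable def dataset (Rmin Rmax : ℝ) (K : ℕ) (raw : ℕ → (X × ℝ) × (X × ℝ)) (n : ℕ) :
    Fin n → X × X × ℝ :=
  fun i => ((raw i).1.1, (raw i).2.1, label Rmin Rmax K (raw i).1.2 (raw i).2.2)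

/-- The contrastive loss: the empirical mean over the dataset of `(w(φ(x₁), φ(x₂)) - y)²`. -/
noncomputable def contrastiveLoss {N n : ℕ} (D : Fin n → X × X × ℝ) (φ : X → Fin N)
    (w : Fin N → Fin N → unitInterval) : ℝ :=
  (∑ i, ((w (φ (D i).1) (φ (D i).2.1) : ℝ) - (D i).2.2) ^ 2) / n

/-- `φ` is an encoder that Z-learning may return on the dataset `D`: together with some regressor
`w : [N] × [N] → [0, 1]` it minimizes the contrastive loss over all encoders `X → [N]` and all
regressors `[N] × [N] → [0, 1]`. -/
def IsZLearningOutput {N n : ℕ} (D : Fin n → X × X × ℝ) (φ : X → Fin N) : Prop :=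
  ∃ w : Fin N → Fin N → unitInterval, ∀ (φ' : X → Fin N) (w' : Fin N → Fin N → unitInterval),
    contrastiveLoss D φ w ≤ contrastiveLoss D φ' w'

/-- A minimizer of the contrastive loss always exists. -/
theorem exists_isZLearningOutput [Finite X] {N n : ℕ} [Nonempty (X → Fin N)]
    (D : Fin n → X × X × ℝ) : ∃ φ : X → Fin N, IsZLearningOutput D φ := by
  have h : ∀ φ : X → Fin N, ∃ w, ∀ w', contrastiveLoss D φ w ≤ contrastiveLoss D φ w' := by
    intro φ
    have hc : Continuous fun w : Fin N → Fin N → unitInterval => contrastiveLoss D φ w := by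
      unfold contrastiveLoss; fun_prop
    obtain ⟨w, -, hw⟩ := isCompact_univ.exists_isMinOn Set.univ_nonempty hc.continuousOn
    exact ⟨w, fun w' => hw (Set.mem_univ w')⟩
  choose w hw using h
  obtain ⟨φ, hφ⟩ := Finite.exists_min fun φ : X → Fin N => contrastiveLoss D φ (w φ)
  exact ⟨φ, w φ, fun φ' w' => (hφ φ').trans (hw φ' w')⟩

end Algorithm

end ZLearning

open ZLearning

/-! Write z(x) for the vector of bin probabilities. Conditionally on x₁ = a, x₂ = b, the label has
mean f(a,b) = 1 - ⟨z(a), z(b)⟩, the Bayes regressor of the squared loss. As N is large enough, some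
irrelevance φ₀ into [N] exists, and f factors through it: f is realizable by a pair (φ₀, w₀).

Any minimizer does at least as well as (φ₀, w₀). Expanding the squares and using the strong law on
each of the finitely many cells (a,b), the excess loss is a frequency-weighted square distance to f
plus a cross term that vanishes uniformly in (φ, w). Full support keeps the frequencies away from
zero, so the minimizers approach f in every cell (`eventually_abs_sub_lt`).

If φ merges a and b, then w(φ·, φ·) takes one value at (a,a), (a,b), (b,b), so f nearly does too.
But ‖z(a) - z(b)‖² = 2f(a,b) - f(a,a) - f(b,b), which is thus below the least nonzero gap and so
zero (`eq_of_abs_sub_lt`). -/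

namespace ZLearning

/-! ### Deterministic analysis of the empirical loss -/

section Deterministic

variable {X : Type*}

open Classical in
/-- The empirical mean of `h y` over a dataset, restricted to the tuples with inputs `a` and `b`. -/
noncomputable def pairMean {n : ℕ} (D : Fin n → X × X × ℝ) (h : ℝ → ℝ) (a b : X) : ℝ :=
  (∑ i, if (D i).1 = a ∧ (D i).2.1 = b then h (D i).2.2 else 0) / n

/-- Each tuple lies in exactly one cell (a,b). -/
theorem sum_pairMean [Fintype X] {n : ℕ} (D : Fin n → X × X × ℝ) (h : X → X → ℝ → ℝ) :
    ∑ a, ∑ b, pairMean D (h a b) a b = (∑ i, h (D i).1 (D i).2.1 (D i).2.2) / n := by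
  classical
  simp only [pairMean, ← Finset.sum_div]
  congr 1
  rw [Finset.sum_congr rfl fun a _ => Finset.sum_comm, Finset.sum_comm]
  refine Finset.sum_congr rfl fun i _ => ?_
  rw [Finset.sum_eq_single (D i).1 (fun a _ ha => by simp [ha.symm]) (by simp),
    Finset.sum_eq_single (D i).2.1 (fun a _ ha => by simp [ha.symm]) (by simp)]
  simp

/-- The excess of the loss of `(φ, w)` over that of a pair `(φ₀, w₀)` representing `f`. -/
theorem contrastiveLoss_sub_eq [Fintype X] {N n : ℕ} (D : Fin n → X × X × ℝ) (f : X → X → ℝ)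
    (φ φ₀ : X → Fin N) (w w₀ : Fin N → Fin N → unitInterval)
    (hf : ∀ a b, (w₀ (φ₀ a) (φ₀ b) : ℝ) = f a b) :
    contrastiveLoss D φ w - contrastiveLoss D φ₀ w₀ =
      ∑ a, ∑ b, (pairMean D (fun _ => 1) a b * ((w (φ a) (φ b) : ℝ) - f a b) ^ 2 +
        2 * ((w (φ a) (φ b) : ℝ) - f a b) * pairMean D (fun y => f a b - y) a b) := by
  -- Per tuple, (u - y)² - (f - y)² = (u - f)² + 2(u - f)(f - y).
  have key : ∀ a b, pairMean D (fun _ => 1) a b * ((w (φ a) (φ b) : ℝ) - f a b) ^ 2 +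
        2 * ((w (φ a) (φ b) : ℝ) - f a b) * pairMean D (fun y => f a b - y) a b =
      pairMean D (fun y => ((w (φ a) (φ b) : ℝ) - y) ^ 2 - (f a b - y) ^ 2) a b := by
    intro a b
    simp only [pairMean]
    rw [div_mul_eq_mul_div, mul_div_assoc', ← add_div, Finset.sum_mul, Finset.mul_sum,
      ← Finset.sum_add_distrib]
    congr 1
    refine Finset.sum_congr rfl fun i _ => ?_
    split_ifs <;> ring
  simp only [key]
  rw [sum_pairMean D fun a b y => ((w (φ a) (φ b) : ℝ) - y) ^ 2 - (f a b - y) ^ 2]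
  simp only [contrastiveLoss, hf, Finset.sum_sub_distrib, sub_div]

theorem pairMean_one_nonneg {n : ℕ} (D : Fin n → X × X × ℝ) (a b : X) :
    0 ≤ pairMean D (fun _ => 1) a b := by
  unfold pairMean
  refine div_nonneg (Finset.sum_nonneg fun i _ => ?_) n.cast_nonneg
  split_ifs <;> norm_num

/-- A pair whose loss is at most that of a pair representing `f` is close to `f` on every input
that occurs with positive frequency, as long as the residuals of `f` are small. -/
theorem pairMean_mul_sq_le [Fintype X] {N n : ℕ} (D : Fin n → X × X × ℝ) (f : X → X → ℝ)
    (φ φ₀ : X → Fin N) (w w₀ : Fin N → Fin N → unitInterval)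
    (hf : ∀ a b, (w₀ (φ₀ a) (φ₀ b) : ℝ) = f a b)
    (hle : contrastiveLoss D φ w ≤ contrastiveLoss D φ₀ w₀) (a b : X) :
    pairMean D (fun _ => 1) a b * ((w (φ a) (φ b) : ℝ) - f a b) ^ 2 ≤
      2 * ∑ a', ∑ b', |pairMean D (fun y => f a' b' - y) a' b'| := by
  have h1 := contrastiveLoss_sub_eq D f φ φ₀ w w₀ hf
  have h2 : ∑ a', ∑ b', pairMean D (fun _ => 1) a' b' * ((w (φ a') (φ b') : ℝ) - f a' b') ^ 2 ≤
      2 * ∑ a', ∑ b', |pairMean D (fun y => f a' b' - y) a' b'| := by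
    have h3 : ∀ a' b', -(2 * |pairMean D (fun y => f a' b' - y) a' b'|) ≤
        2 * ((w (φ a') (φ b') : ℝ) - f a' b') * pairMean D (fun y => f a' b' - y) a' b' := by
      intro a' b'
      -- Both values lie in [0,1]; this makes the bound on the cross term independent of φ and w.
      have hd : |(w (φ a') (φ b') : ℝ) - f a' b'| ≤ 1 := by
        rw [← hf, abs_le]
        have := (w (φ a') (φ b')).2
        have := (w₀ (φ₀ a') (φ₀ b')).2
        simp only [Set.mem_Icc] at *
        constructor <;> linarith
      have := mul_le_mul_of_nonneg_right hd (abs_nonneg (pairMean D (fun y => f a' b' - y) a' b'))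
      rw [← abs_mul] at this
      have := (abs_le.1 this).1
      linarith
    have h4 := Finset.sum_le_sum fun a' (_ : a' ∈ Finset.univ) =>
      Finset.sum_le_sum fun b' (_ : b' ∈ Finset.univ) => h3 a' b'
    simp only [Finset.sum_add_distrib] at h1
    simp only [Finset.sum_neg_distrib, ← Finset.mul_sum] at h4
    linarith
  have hnn : ∀ a' b', 0 ≤ pairMean D (fun _ => 1) a' b' * ((w (φ a') (φ b') : ℝ) - f a' b') ^ 2 :=
    fun a' b' => mul_nonneg (pairMean_one_nonneg D a' b') (sq_nonneg _)
  refine le_trans ?_ h2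
  refine (Finset.single_le_sum (fun b' _ => hnn a b') (Finset.mem_univ b)).trans ?_
  exact Finset.single_le_sum
    (f := fun a' => ∑ b', pairMean D (fun _ => 1) a' b' * ((w (φ a') (φ b') : ℝ) - f a' b') ^ 2)
    (fun a' _ => Finset.sum_nonneg fun b' _ => hnn a' b') (Finset.mem_univ a)

/-- Consistency of the minimizers of the contrastive loss, along datasets whose frequencies
converge to positive limits and on which the residuals of a representable `f` vanish. -/
theorem eventually_abs_sub_lt [Finite X] {N : ℕ} (D : ∀ n, Fin n → X × X × ℝ) (f p : X → X → ℝ)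
    (φ₀ : X → Fin N) (w₀ : Fin N → Fin N → unitInterval)
    (hf : ∀ a b, (w₀ (φ₀ a) (φ₀ b) : ℝ) = f a b) (hp : ∀ a b, 0 < p a b)
    (hfreq : ∀ a b, Tendsto (fun n => pairMean (D n) (fun _ => 1) a b) atTop (𝓝 (p a b)))
    (hres : ∀ a b, Tendsto (fun n => pairMean (D n) (fun y => f a b - y) a b) atTop (𝓝 0))
    {δ : ℝ} (hδ : 0 < δ) :
    ∀ᶠ n in atTop, ∀ (φ : X → Fin N) (w : Fin N → Fin N → unitInterval),
      contrastiveLoss (D n) φ w ≤ contrastiveLoss (D n) φ₀ w₀ →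
        ∀ a b, |(w (φ a) (φ b) : ℝ) - f a b| < δ := by
  have := Fintype.ofFinite X
  have h1 : Tendsto (fun n => 2 * ∑ a, ∑ b, |pairMean (D n) (fun y => f a b - y) a b|) atTop
      (𝓝 0) := by
    have := (tendsto_finsetSum Finset.univ fun a _ => tendsto_finsetSum Finset.univ fun b _ =>
      (hres a b).abs).const_mul 2
    simpa using this
  -- The left side tends to 0 and the right side to p(a,b)δ² > 0. Neither involves φ or w, so one
  -- threshold for n serves all pairs.
  have h2 : ∀ a b, ∀ᶠ n in atTop, 2 * ∑ a, ∑ b, |pairMean (D n) (fun y => f a b - y) a b| <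
      pairMean (D n) (fun _ => 1) a b * δ ^ 2 := fun a b =>
    h1.eventually_lt ((hfreq a b).mul_const (δ ^ 2)) (mul_pos (hp a b) (pow_pos hδ 2))
  filter_upwards [eventually_all.2 fun a => eventually_all.2 fun b => h2 a b] with n hn φ w hle a b
  have h3 := (pairMean_mul_sq_le (D n) f φ φ₀ w w₀ hf hle a b).trans_lt (hn a b)
  exact abs_lt_of_sq_lt_sq (lt_of_mul_lt_mul_left h3 (pairMean_one_nonneg _ a b)) hδ.le

/-- If the kernel `1 - ⟨z a, z b⟩` is, up to an error less than `‖z a - z b‖² / 4`, a function of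
codes that agree on `a` and `b`, then `z a = z b`. -/
theorem eq_of_abs_sub_lt {ι κ : Type*} [Fintype κ] (z : X → κ → ℝ) (φ : X → ι) (w : ι → ι → ℝ)
    {δ : ℝ} (hw : ∀ a b, |w (φ a) (φ b) - (1 - ∑ k, z a k * z b k)| < δ)
    (hδ : ∀ a b, z a ≠ z b → 4 * δ ≤ ∑ k, (z a k - z b k) ^ 2) {a b : X} (hab : φ a = φ b) :
    z a = z b := by
  by_contra hne
  have h := hδ a b hne
  have haa := abs_lt.1 (hw a a)
  have h_ab := abs_lt.1 (hw a b)
  have hbb := abs_lt.1 (hw b b)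
  simp only [hab] at haa h_ab hbb
  have : ∑ k, (z a k - z b k) ^ 2 =
      ∑ k, z a k * z a k - 2 * ∑ k, z a k * z b k + ∑ k, z b k * z b k := by
    rw [Finset.mul_sum, ← Finset.sum_sub_distrib, ← Finset.sum_add_distrib]
    exact Finset.sum_congr rfl fun k _ => by ring
  -- Each of the inner products (a,a), (a,b), (b,b), counted with weights 1, 2, 1, costs an error
  -- below δ: hence the factor 4.
  linarith [haa.1, h_ab.2, hbb.1]

/-- Finitely many pairs have finitely many positive gaps. -/
theorem exists_pos_le_sum_sq [Finite X] {κ : Type*} [Fintype κ] (z : X → κ → ℝ) :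
    ∃ δ > 0, ∀ a b, z a ≠ z b → 4 * δ ≤ ∑ k, (z a k - z b k) ^ 2 := by
  have h : ∀ q : X × X, ∀ᶠ δ in 𝓝[>] (0 : ℝ),
      z q.1 ≠ z q.2 → 4 * δ ≤ ∑ k, (z q.1 k - z q.2 k) ^ 2 := by
    intro q
    by_cases hq : z q.1 = z q.2
    · simp [hq]
    · have hpos : 0 < ∑ k, (z q.1 k - z q.2 k) ^ 2 := by
        obtain ⟨k, hk⟩ := Function.ne_iff.1 hq
        exact Finset.sum_pos' (fun _ _ => sq_nonneg _)
          ⟨k, Finset.mem_univ k, sq_pos_of_ne_zero (sub_ne_zero.2 hk)⟩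
      have : ∀ᶠ δ in 𝓝[>] (0 : ℝ), δ < (∑ k, (z q.1 k - z q.2 k) ^ 2) / 4 :=
        nhdsWithin_le_nhds (gt_mem_nhds (by positivity))
      filter_upwards [this] with δ hδ _
      linarith
  obtain ⟨δ, hδ, hpos⟩ := ((eventually_all.2 h).and self_mem_nhdsWithin).exists
  exact ⟨δ, hpos, fun a b => hδ (a, b)⟩

end Deterministic

end ZLearning

namespace ZLearning

/-! ### Disjointness of the bins -/

section Bins

variable {Rmin Rmax : ℝ} {K : ℕ}

theorem measurableSet_returnBin (k : Fin K) : MeasurableSet (returnBin Rmin Rmax K k) := by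
  have : returnBin Rmin Rmax K k = (Set.Ioi (binEdge Rmin Rmax K k) ∪
      {R | (k : ℕ) = 0 ∧ R = Rmin}) ∩ Set.Iic (binEdge Rmin Rmax K (k + 1)) := by
    ext; simp [returnBin]
  rw [this]
  refine (measurableSet_Ioi.union ?_).inter measurableSet_Iic
  exact (MeasurableSet.const _).inter (measurableSet_singleton Rmin)

theorem binEdge_mono (h : Rmin ≤ Rmax) : Monotone (binEdge Rmin Rmax K) := by
  intro i j hij
  have : 0 ≤ (Rmax - Rmin) / K := div_nonneg (sub_nonneg.2 h) K.cast_nonneg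
  unfold binEdge
  gcongr

theorem eq_of_mem_returnBin (h : Rmin ≤ Rmax) {R : ℝ} {k l : Fin K}
    (hk : R ∈ returnBin Rmin Rmax K k) (hl : R ∈ returnBin Rmin Rmax K l) : k = l := by
  have key : ∀ {k l : Fin K}, R ∈ returnBin Rmin Rmax K k → R ∈ returnBin Rmin Rmax K l →
      ¬ k < l := by
    intro k l hk hl hkl
    have h1 : binEdge Rmin Rmax K (k + 1) ≤ binEdge Rmin Rmax K l := binEdge_mono h hkl
    rcases hl.1 with h2 | ⟨h2, -⟩
    · exact absurd (hk.2.trans h1) h2.not_ge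
    · exact absurd (Fin.lt_def.1 hkl) (by omega)
  exact le_antisymm (not_lt.1 (key hl hk)) (not_lt.1 (key hk hl))

/-- Since the bins are disjoint, at most one summand is nonzero. Each summand is a product event,
whose probability factors under independent returns. -/
theorem one_sub_label_eq_sum (h : Rmin ≤ Rmax) (R₁ R₂ : ℝ) :
    1 - label Rmin Rmax K R₁ R₂ = ∑ k : Fin K,
      (returnBin Rmin Rmax K k ×ˢ returnBin Rmin Rmax K k).indicator (fun _ => (1 : ℝ))
        (R₁, R₂) := by
  classical
  unfold label
  split_ifs with hk
  · obtain ⟨k, h1, h2⟩ := hk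
    rw [Finset.sum_eq_single k _ (by simp), Set.indicator_of_mem (Set.mk_mem_prod h1 h2), sub_zero]
    intro l _ hl
    exact Set.indicator_of_notMem (fun hm => hl (eq_of_mem_returnBin h hm.1 h1)) _
  · rw [sub_self, Finset.sum_eq_zero]
    intro k _
    exact Set.indicator_of_notMem (fun hm => hk ⟨k, hm.1, hm.2⟩) _

end Bins

/-! ### Realizability of the target and laws of large numbers -/

section Sampling

variable {S A : Type*} [MeasurableSpace S] [MeasurableSpace A]

theorem sum_binnedReturn_le_one (M : MDP S A) (π : Kernel S A) [IsMarkovKernel π] {Rmin Rmax : ℝ}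
    (h : Rmin ≤ Rmax) (K : ℕ) (x : S × A) : ∑ k, binnedReturn M π Rmin Rmax K x k ≤ 1 := by
  unfold binnedReturn
  rw [← measureReal_biUnion_finset (fun k _ l _ hkl => Set.disjoint_left.2 fun _ hk hl =>
    hkl (eq_of_mem_returnBin h hk hl)) fun k _ => measurableSet_returnBin k]
  exact measureReal_le_one

theorem one_sub_inner_binnedReturn_mem (M : MDP S A) (π : Kernel S A) [IsMarkovKernel π]
    {Rmin Rmax : ℝ} (h : Rmin ≤ Rmax) (K : ℕ) (a b : S × A) :
    1 - ∑ k, binnedReturn M π Rmin Rmax K a k * binnedReturn M π Rmin Rmax K b k ∈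
      Set.Icc (0 : ℝ) 1 := by
  have hnn : ∀ x k, 0 ≤ binnedReturn M π Rmin Rmax K x k := fun x k => measureReal_nonneg
  have h1 : ∑ k, binnedReturn M π Rmin Rmax K a k * binnedReturn M π Rmin Rmax K b k ≤ 1 :=
    (Finset.sum_le_sum fun k _ => mul_le_of_le_one_right (hnn a k) measureReal_le_one).trans
      (sum_binnedReturn_le_one M π h K a)
  have h2 : 0 ≤ ∑ k, binnedReturn M π Rmin Rmax K a k * binnedReturn M π Rmin Rmax K b k :=
    Finset.sum_nonneg fun k _ => mul_nonneg (hnn a k) (hnn b k)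
  exact ⟨sub_nonneg.2 h1, sub_le_self _ h2⟩

theorem exists_isZIrrelevance [Finite S] [Finite A] (M : MDP S A) (π : Kernel S A)
    [IsMarkovKernel π] (Rmin Rmax : ℝ) (K : ℕ) {N : ℕ}
    (hN : minAbstractSize M π Rmin Rmax K ≤ N) :
    ∃ φ : S × A → Fin N, IsZIrrelevance M π Rmin Rmax K φ := by
  -- Nonemptiness ensures that the infimum is attained; an enumeration of the state-action pairs is
  -- a witness.
  have hne : {N | ∃ φ : S × A → Fin N, IsZIrrelevance M π Rmin Rmax K φ}.Nonempty :=
    ⟨Nat.card (S × A), Finite.equivFin (S × A), fun x₁ x₂ h => by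
      rw [(Finite.equivFin (S × A)).injective h]⟩
  obtain ⟨φ, hφ⟩ := Nat.sInf_mem hne
  exact ⟨fun x => Fin.castLE hN (φ x), fun x₁ x₂ h => hφ x₁ x₂ (Fin.castLE_injective hN h)⟩

/-- The target `1 - ⟨z a, z b⟩` is represented by any irrelevance. -/
theorem exists_regressor_of_isZIrrelevance [Nonempty (S × A)] (M : MDP S A) (π : Kernel S A)
    [IsMarkovKernel π] {Rmin Rmax : ℝ} (h : Rmin ≤ Rmax) (K : ℕ) {N : ℕ} {φ : S × A → Fin N}
    (hφ : IsZIrrelevance M π Rmin Rmax K φ) :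
    ∃ w : Fin N → Fin N → unitInterval, ∀ a b, (w (φ a) (φ b) : ℝ) =
      1 - ∑ k, binnedReturn M π Rmin Rmax K a k * binnedReturn M π Rmin Rmax K b k := by
  -- Evaluate the target at a representative of each code; codes outside the range of φ get an
  -- arbitrary one.
  refine ⟨fun i j => ⟨_, one_sub_inner_binnedReturn_mem M π h K
    (Function.invFun φ i) (Function.invFun φ j)⟩, fun a b => ?_⟩
  have hinv : ∀ x, binnedReturn M π Rmin Rmax K (Function.invFun φ (φ x)) =
      binnedReturn M π Rmin Rmax K x := fun x => hφ _ _ (Function.invFun_eq ⟨x, rfl⟩)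
  simp only [hinv]

variable [Finite S] [Finite A] [MeasurableSingletonClass S] [MeasurableSingletonClass A]

instance (M : MDP S A) (π : Kernel S A) [IsMarkovKernel π] (d : PMF (S × A)) :
    IsProbabilityMeasure (sampleLaw M π d) := by
  have : IsMarkovKernel (Kernel.ofFunOfCountable (returnLaw M π)) :=
    ⟨fun x => inferInstanceAs (IsProbabilityMeasure (returnLaw M π x))⟩
  unfold sampleLaw
  infer_instance

theorem sampleLaw_real_prod (M : MDP S A) (π : Kernel S A) [IsMarkovKernel π] (d : PMF (S × A))
    (a b : S × A) {B C : Set ℝ} (hB : MeasurableSet B) (hC : MeasurableSet C) :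
    (sampleLaw M π d).real (({a} ×ˢ B) ×ˢ ({b} ×ˢ C)) =
      (d a).toReal * (returnLaw M π a).real B * ((d b).toReal * (returnLaw M π b).real C) := by
  have : IsMarkovKernel (Kernel.ofFunOfCountable (returnLaw M π)) :=
    ⟨fun x => inferInstanceAs (IsProbabilityMeasure (returnLaw M π x))⟩
  have key : ∀ (x : S × A) {B : Set ℝ}, MeasurableSet B →
      (d.toMeasure.compProd (Kernel.ofFunOfCountable (returnLaw M π))).real ({x} ×ˢ B) =
        (d x).toReal * (returnLaw M π x).real B := by
    intro x B hB
    rw [measureReal_def, Measure.compProd_apply_prod (measurableSet_singleton x) hB,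
      Measure.restrict_singleton, lintegral_smul_measure, lintegral_dirac,
      PMF.toMeasure_apply_singleton _ _ (measurableSet_singleton x), smul_eq_mul,
      ENNReal.toReal_mul]
    rfl
  rw [sampleLaw, measureReal_prod_prod, key a hB, key b hC]

variable {Ω : Type*} [MeasurableSpace Ω] {μ : Measure Ω}

/-- The strong law of large numbers for a bounded statistic of the raw data. -/
theorem ae_tendsto_average [IsProbabilityMeasure μ] {E : Type*} [MeasurableSpace E]
    {raw : ℕ → Ω → E} (hmeas : ∀ i, Measurable (raw i)) (hindep : iIndepFun raw μ) {ν : Measure E}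
    (hlaw : ∀ i, μ.map (raw i) = ν) {g : E → ℝ} (hg : Measurable g) (hint : Integrable g ν) :
    ∀ᵐ ω ∂μ, Tendsto (fun n : ℕ => (∑ i : Fin n, g (raw i ω)) / n) atTop (𝓝 (∫ e, g e ∂ν)) := by
  have h := strong_law_ae_real (μ := μ) (fun i => g ∘ raw i)
    (Integrable.comp_measurable (by rwa [hlaw]) (hmeas 0))
    (fun i j hij => (hindep.indepFun hij).comp hg hg)
    (fun i => IdentDistrib.comp ⟨(hmeas i).aemeasurable, (hmeas 0).aemeasurable,
      (hlaw i).trans (hlaw 0).symm⟩ hg)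
  have hE : ∫ ω, (g ∘ raw 0) ω ∂μ = ∫ e, g e ∂ν := by
    rw [← hlaw 0, integral_map (hmeas 0).aemeasurable hg.aestronglyMeasurable]
    rfl
  rw [hE] at h
  simpa only [Function.comp_apply, Finset.sum_range] using h

theorem integral_indicator_sampleLaw (M : MDP S A) (π : Kernel S A) [IsMarkovKernel π]
    (d : PMF (S × A)) (a b : S × A) {B C : Set ℝ} (hB : MeasurableSet B) (hC : MeasurableSet C) :
    ∫ e, (({a} ×ˢ B) ×ˢ ({b} ×ˢ C)).indicator (fun _ => (1 : ℝ)) e ∂(sampleLaw M π d) =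
      (d a).toReal * (returnLaw M π a).real B * ((d b).toReal * (returnLaw M π b).real C) := by
  rw [integral_indicator_const _ (((measurableSet_singleton a).prod hB).prod
    ((measurableSet_singleton b).prod hC)), smul_eq_mul, mul_one, sampleLaw_real_prod _ _ _ _ _ hB hC]

theorem ae_tendsto_pairMean_one [IsProbabilityMeasure μ] (M : MDP S A) (π : Kernel S A)
    [IsMarkovKernel π] (d : PMF (S × A)) (Rmin Rmax : ℝ) (K : ℕ)
    {raw : ℕ → Ω → ((S × A) × ℝ) × ((S × A) × ℝ)} (hmeas : ∀ i, Measurable (raw i))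
    (hindep : iIndepFun raw μ) (hlaw : ∀ i, μ.map (raw i) = sampleLaw M π d) (a b : S × A) :
    ∀ᵐ ω ∂μ, Tendsto (fun n => pairMean (dataset Rmin Rmax K (fun i => raw i ω) n)
      (fun _ => 1) a b) atTop (𝓝 ((d a).toReal * (d b).toReal)) := by
  have hs : MeasurableSet (({a} ×ˢ Set.univ) ×ˢ ({b} ×ˢ Set.univ) :
      Set (((S × A) × ℝ) × ((S × A) × ℝ))) :=
    ((measurableSet_singleton a).prod .univ).prod ((measurableSet_singleton b).prod .univ)
  have h := ae_tendsto_average hmeas hindep hlaw (measurable_const.indicator hs)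
    ((integrable_const (1 : ℝ)).indicator hs)
  rw [integral_indicator_sampleLaw M π d a b .univ .univ] at h
  simp only [probReal_univ, mul_one] at h
  filter_upwards [h] with ω hω
  refine hω.congr fun n => ?_
  unfold pairMean
  congr 1
  refine Finset.sum_congr rfl fun i _ => ?_
  by_cases hi : (raw i ω).1.1 = a ∧ (raw i ω).2.1 = b
  · have hm : raw i ω ∈ (({a} ×ˢ Set.univ) ×ˢ ({b} ×ˢ Set.univ) :
        Set (((S × A) × ℝ) × ((S × A) × ℝ))) := ⟨⟨hi.1, trivial⟩, ⟨hi.2, trivial⟩⟩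
    rw [Set.indicator_of_mem hm]
    exact (if_pos hi).symm
  · rw [Set.indicator_of_notMem fun hm => hi ⟨hm.1.1, hm.2.1⟩]
    exact (if_neg hi).symm

/-- The residual is (1 - y) - ⟨z(a), z(b)⟩. On the cell (a,b), the mean of 1 - y tends to
d(a)d(b)⟨z(a), z(b)⟩, and the subtracted constant is weighted by a frequency tending to d(a)d(b). -/
theorem ae_tendsto_pairMean_residual [IsProbabilityMeasure μ] (M : MDP S A) (π : Kernel S A)
    [IsMarkovKernel π] (d : PMF (S × A)) {Rmin Rmax : ℝ} (h : Rmin ≤ Rmax) (K : ℕ)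
    {raw : ℕ → Ω → ((S × A) × ℝ) × ((S × A) × ℝ)} (hmeas : ∀ i, Measurable (raw i))
    (hindep : iIndepFun raw μ) (hlaw : ∀ i, μ.map (raw i) = sampleLaw M π d) (a b : S × A) :
    ∀ᵐ ω ∂μ, Tendsto (fun n => pairMean (dataset Rmin Rmax K (fun i => raw i ω) n)
      (fun y => 1 - ∑ k, binnedReturn M π Rmin Rmax K a k * binnedReturn M π Rmin Rmax K b k - y)
      a b) atTop (𝓝 0) := by
  classical
  have hs : ∀ k : Fin K, MeasurableSet (({a} ×ˢ returnBin Rmin Rmax K k) ×ˢ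
      ({b} ×ˢ returnBin Rmin Rmax K k) : Set (((S × A) × ℝ) × ((S × A) × ℝ))) := fun k =>
    ((measurableSet_singleton a).prod (measurableSet_returnBin k)).prod
      ((measurableSet_singleton b).prod (measurableSet_returnBin k))
  have hE : ∀ k : Fin K, ∀ᵐ ω ∂μ, Tendsto (fun n : ℕ => (∑ i : Fin n,
      (({a} ×ˢ returnBin Rmin Rmax K k) ×ˢ ({b} ×ˢ returnBin Rmin Rmax K k)).indicator
        (fun _ => (1 : ℝ)) (raw i ω)) / n) atTop
      (𝓝 ((d a).toReal * binnedReturn M π Rmin Rmax K a k *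
        ((d b).toReal * binnedReturn M π Rmin Rmax K b k))) := by
    intro k
    have h := ae_tendsto_average hmeas hindep hlaw (measurable_const.indicator (hs k))
      ((integrable_const (1 : ℝ)).indicator (hs k))
    rwa [integral_indicator_sampleLaw M π d a b (measurableSet_returnBin k)
      (measurableSet_returnBin k)] at h
  filter_upwards [ae_all_iff.2 hE,
    ae_tendsto_pairMean_one M π d Rmin Rmax K hmeas hindep hlaw a b] with ω hω hω'
  have hlim := (tendsto_finsetSum Finset.univ fun k _ => hω k).sub (hω'.const_mul
    (∑ k, binnedReturn M π Rmin Rmax K a k * binnedReturn M π Rmin Rmax K b k))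
  have h0 : ∑ k, (d a).toReal * binnedReturn M π Rmin Rmax K a k *
      ((d b).toReal * binnedReturn M π Rmin Rmax K b k) -
      (∑ k, binnedReturn M π Rmin Rmax K a k * binnedReturn M π Rmin Rmax K b k) *
        ((d a).toReal * (d b).toReal) = 0 := by
    rw [Finset.sum_mul, sub_eq_zero]
    exact Finset.sum_congr rfl fun k _ => by ring
  rw [h0] at hlim
  refine hlim.congr fun n => ?_
  simp only [pairMean]
  rw [← Finset.sum_div, Finset.sum_comm, mul_div_assoc', ← sub_div, Finset.mul_sum,
    ← Finset.sum_sub_distrib]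
  congr 1
  refine Finset.sum_congr rfl fun i _ => ?_
  by_cases hi : (raw i ω).1.1 = a ∧ (raw i ω).2.1 = b
  · have hi' : (dataset Rmin Rmax K (fun i => raw i ω) n i).1 = a ∧
        (dataset Rmin Rmax K (fun i => raw i ω) n i).2.1 = b := hi
    have hsum := one_sub_label_eq_sum (K := K) h (raw i ω).1.2 (raw i ω).2.2
    have hind : ∀ k : Fin K, (({a} ×ˢ returnBin Rmin Rmax K k) ×ˢ
        ({b} ×ˢ returnBin Rmin Rmax K k)).indicator (fun _ => (1 : ℝ)) (raw i ω) =
        (returnBin Rmin Rmax K k ×ˢ returnBin Rmin Rmax K k).indicator (fun _ => (1 : ℝ))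
          ((raw i ω).1.2, (raw i ω).2.2) := fun k => by
      simp [Set.indicator_apply, Set.mem_prod, hi.1, hi.2]
    rw [if_pos hi', if_pos hi', Finset.sum_congr rfl fun k _ => hind k, ← hsum]
    simp only [dataset]
    ring
  · have hi' : ¬((dataset Rmin Rmax K (fun i => raw i ω) n i).1 = a ∧
        (dataset Rmin Rmax K (fun i => raw i ω) n i).2.1 = b) := hi
    rw [if_neg hi', if_neg hi', mul_zero, sub_zero]
    exact Finset.sum_eq_zero fun k _ =>
      Set.indicator_of_notMem (fun hm => hi ⟨hm.1.1, hm.2.1⟩) _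

end Sampling

/-- An almost surely eventual property holds with probability tending to one. -/
theorem tendsto_measure_of_ae_eventually {Ω : Type*} [MeasurableSpace Ω] {μ : Measure Ω}
    [IsProbabilityMeasure μ] {P : ℕ → Ω → Prop} (h : ∀ᵐ ω ∂μ, ∀ᶠ n in atTop, P n ω) :
    Tendsto (fun n => μ {ω | P n ω}) atTop (𝓝 1) := by
  -- The events that P holds from n on increase to an event of full measure and lie inside {P n}.
  have hmono : Monotone fun n => {ω | ∀ m ≥ n, P m ω} :=
    fun i j hij ω hω m hm => hω m (hij.trans hm)
  have hU : μ (⋃ n, {ω | ∀ m ≥ n, P m ω}) = 1 := by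
    rw [← measure_univ (μ := μ)]
    refine measure_congr (eventuallyEq_univ.2 ?_)
    filter_upwards [h] with ω hω
    exact Set.mem_iUnion.2 (eventually_atTop.1 hω)
  have hlim := tendsto_measure_iUnion_atTop (μ := μ) hmono
  rw [hU] at hlim
  exact tendsto_of_tendsto_of_tendsto_of_le_of_le hlim tendsto_const_nhds
    (fun n => measure_mono fun ω hω => hω n le_rfl) fun n => prob_le_one

end ZLearning

/-! ### Consistency of Z-learning -/

theorem corollary1 {S A : Type*} [Finite S] [Finite A]
    [MeasurableSpace S] [MeasurableSingletonClass S]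
    [MeasurableSpace A] [MeasurableSingletonClass A]
    (M : MDP S A) (π : Kernel S A) [IsMarkovKernel π]
    (Rmin Rmax : ℝ) (hR : ReturnsIn M π Rmin Rmax)
    (K : ℕ) (hK : 1 ≤ K) (N : ℕ) (hN : minAbstractSize M π Rmin Rmax K ≤ N)
    (d : PMF (S × A)) (hd : d.support = Set.univ)
    {Ω : Type*} [MeasurableSpace Ω] (μ : Measure Ω) [IsProbabilityMeasure μ]
    (raw : ℕ → Ω → ((S × A) × ℝ) × ((S × A) × ℝ))
    (hraw_meas : ∀ i, Measurable (raw i))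
    (hraw_indep : iIndepFun raw μ)
    (hraw_law : ∀ i, μ.map (raw i) = sampleLaw M π d) :
    (∀ᵐ ω ∂μ, ∀ᶠ n in atTop, ∀ φ : S × A → Fin N,
      IsZLearningOutput (dataset Rmin Rmax K (fun i => raw i ω) n) φ →
        IsZIrrelevance M π Rmin Rmax K φ) ∧
    Tendsto (fun n => μ {ω | ∀ φ : S × A → Fin N,
      IsZLearningOutput (dataset Rmin Rmax K (fun i => raw i ω) n) φ →
        IsZIrrelevance M π Rmin Rmax K φ}) atTop (𝓝 1) := by
  obtain ⟨φ₀, hφ₀⟩ := exists_isZIrrelevance M π Rmin Rmax K hN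
  have hX : Nonempty (S × A) := ⟨d.support_nonempty.some⟩
  -- An almost sure event is nonempty, so some return lies in the interval.
  have hle : Rmin ≤ Rmax := by
    obtain ⟨τ, -, hτ⟩ := (hR hX.some).exists
    exact hτ.1.trans hτ.2
  obtain ⟨w₀, hw₀⟩ := exists_regressor_of_isZIrrelevance M π hle K hφ₀
  obtain ⟨δ, hδ, hsep⟩ := exists_pos_le_sum_sq (binnedReturn M π Rmin Rmax K)
  have hd_pos : ∀ a, 0 < (d a).toReal := fun a =>
    ENNReal.toReal_pos ((d.mem_support_iff a).1 (hd ▸ Set.mem_univ a)) (d.apply_ne_top a)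
  have hmain : ∀ᵐ ω ∂μ, ∀ᶠ n in atTop, ∀ φ : S × A → Fin N,
      IsZLearningOutput (dataset Rmin Rmax K (fun i => raw i ω) n) φ →
        IsZIrrelevance M π Rmin Rmax K φ := by
    filter_upwards [ae_all_iff.2 fun a => ae_all_iff.2 fun b =>
        ae_tendsto_pairMean_one M π d Rmin Rmax K hraw_meas hraw_indep hraw_law a b,
      ae_all_iff.2 fun a => ae_all_iff.2 fun b =>
        ae_tendsto_pairMean_residual M π d hle K hraw_meas hraw_indep hraw_law a b] with ω h1 h2
    filter_upwards [eventually_abs_sub_lt (fun n => dataset Rmin Rmax K (fun i => raw i ω) n)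
      _ _ φ₀ w₀ hw₀ (fun a b => mul_pos (hd_pos a) (hd_pos b)) h1 h2 hδ] with n hn φ ⟨w, hw⟩ x₁ x₂ hx
    exact eq_of_abs_sub_lt _ φ (fun i j => (w i j : ℝ)) (hn φ w (hw φ₀ w₀)) hsep hx
  exact ⟨hmain, tendsto_measure_of_ae_eventually hmain⟩
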